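/- **Theorem (Type I approximation problem).** Let $n\ge 1$, and let $0<\lambda_1<\dots<\lambda_{n-1}$, $b_1,\dots,b_{n-1}<0$ and $M>0$ be arbitrary real numbers. Put $$c_i=-\sum_{j=1}^{n-1}\frac{b_jb_i}{\lambda_j+\lambda_i},\qquad W(z)=\sum_{i=1}^{n-1}\frac{b_i}{z-\lambda_i},\qquad Z(z)=-\frac{1}{2Mz}+\sum_{i=1}^{n-1}\frac{c_i}{z-\lambda_i},$$ $$W^*(z)=-W(-z),\qquad Z^*(z)=Z(-z),\qquad I_{ij}=\sum_{p,q=1}^{n-1}\frac{\lambda_p^{\,i}\lambda_q^{\,j}}{\lambda_p+\lambda_q}\,b_pb_q .$$ Let $\mathcal A_k$ be the determinant of the $k\times k$ matrix $\bigl(I_{ij}+\tfrac1{2M}\delta_{i0}\delta_{j0}\bigr)_{0\le i,j\le k-1}$, and let $\mathcal B_k=\det(I_{ij})_{0\le i,j\le k-1}$ and $\mathcal C_k=\det(I_{ij})_{1\le i,j\le k}$ (all equal to $1$ for $k=0$). Fix $0\le k\le n-1$. There are polynomials $Q,P,\widehat P$ with real coefficients, of degrees exactly $k+1,k,k$ respectively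 (where for $k=0$ the polynomial $P$ is zero, counted as having degree $0$), such that, as $z\to\infty$ in $\mathbb C$, 1. (approximation) $QZ-\widehat P=O(z^{-1})$ and $QW-P=O(1)$; 2. (symmetry) $\widehat P+PW^*+QZ^*=O(z^{-(k+1)})$; 3. (normalization) $Q(0)=0$, $P(0)=0$, $\widehat P(0)=1$. They are unique, even among all triples of complex polynomials of degrees at most $k+1,k,k$ satisfying 1–3. The coefficients of $Q(z)=\sum_{j=1}^{k+1}q_jz^j$ form the unique solution of the $(k+1)\times(k+1)$ linear system $$\Bigl(I_{ij}+\tfrac{1}{2M}\delta_{i0}\delta_{j0}\Bigr)_{0\le i,j\le k}\,(q_1,\dots,q_{k+1})^t=-(1,0,\dots,0)^t,$$ whose determinant is $$\mathcal A_{k+1}=\mathcal B_{k+1}+\frac{1}{2M}\,\mathcal C_k>0 .$$ The polynomials $P,\widehat P$ are determined from $Q$ by $$P=\Pi_{>0}(WQ),\qquad \widehat P=\Pi_{\ge0}(ZQ)=-\frac1{2M}\,\frac{Q(z)-Q(0)}{z}+\sum_{i=1}^{n-1}c_i\,\frac{Q(z)-Q(\lambda_i)}{z-\lambda_i},$$ where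 $\Pi_{>0}$ and $\Pi_{\ge0}$ denote the part with positive, respectively nonnegative, powers of $z$ of the Laurent expansion at $z=\infty$. -/

import Mathlib

open Polynomial

noncomputable section

namespace CubicString

/-! Spectral data are nodes `lam : Fin m → ℝ`, weights `b : Fin m → ℝ` and a number `M : ℝ`;
the discrete signed measures are
`μ = ∑ i, b i • δ_{lam i}` and `ν = -(1 / (2 M)) • δ_0 + ∑ i, c i • δ_{lam i}`,
and integrals against them are the corresponding finite sums. -/

/-- The weights `c i = -∑ j, b j * b i / (lam j + lam i)` of `ν` at the nodes. -/
def cWeight {m : ℕ} (lam b : Fin m → ℝ) (i : Fin m) : ℝ :=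
  -∑ j, b j * b i / (lam j + lam i)

/-- `W(z) = ∫ dμ(λ) / (z - λ)`. -/
def W {m : ℕ} (lam b : Fin m → ℝ) (z : ℂ) : ℂ :=
  ∑ i, (b i : ℂ) / (z - (lam i : ℂ))

/-- `Z(z) = ∫ dν(λ) / (z - λ)`. -/
def Z {m : ℕ} (lam b : Fin m → ℝ) (M : ℝ) (z : ℂ) : ℂ :=
  -((1 / (2 * M) : ℝ) : ℂ) / z + ∑ i, (cWeight lam b i : ℂ) / (z - (lam i : ℂ))

/-- `W*(z) = -W(-z)`. -/
def Wstar {m : ℕ} (lam b : Fin m → ℝ) (z : ℂ) : ℂ := -W lam b (-z)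

/-- `Z*(z) = Z(-z)`. -/
def Zstar {m : ℕ} (lam b : Fin m → ℝ) (M : ℝ) (z : ℂ) : ℂ := Z lam b M (-z)

/-- The bimoments `I i j = ∬ κ ^ i * λ ^ j / (κ + λ) dμ(κ) dμ(λ)`. -/
def bimoment {m : ℕ} (lam b : Fin m → ℝ) (i j : ℕ) : ℝ :=
  ∑ p, ∑ q, lam p ^ i * lam q ^ j / (lam p + lam q) * b p * b q

/-- The `k × k` matrix `(I i j)`, `0 ≤ i, j < k`, with `1 / (2 M)` added to the entry `(0, 0)`. -/
def matA {m : ℕ} (lam b : Fin m → ℝ) (M : ℝ) (k : ℕ) : Matrix (Fin k) (Fin k) ℝ :=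
  Matrix.of fun i j =>
    bimoment lam b i j + if (i : ℕ) = 0 ∧ (j : ℕ) = 0 then 1 / (2 * M) else 0

/-- The determinant `A_k` (equal to `1` for `k = 0`). -/
def detA {m : ℕ} (lam b : Fin m → ℝ) (M : ℝ) (k : ℕ) : ℝ := (matA lam b M k).det

/-- The `k × k` determinant `B_k = det (I i j)`, `0 ≤ i, j < k` (equal to `1` for `k = 0`). -/
def detB {m : ℕ} (lam b : Fin m → ℝ) (k : ℕ) : ℝ :=
  (Matrix.of fun i j : Fin k => bimoment lam b i j).det

/-- The `k × k` determinant `C_k = det (I i j)`, `1 ≤ i, j ≤ k` (equal to `1` for `k = 0`). -/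
def detC {m : ℕ} (lam b : Fin m → ℝ) (k : ℕ) : ℝ :=
  (Matrix.of fun i j : Fin k => bimoment lam b (i + 1) (j + 1)).det

/-- The approximation, symmetry and normalization conditions of the `k`-th approximation problem
of type I; `z → ∞` in the complex plane. -/
structure IsTypeI {m : ℕ} (lam b : Fin m → ℝ) (M : ℝ) (k : ℕ) (Q P Phat : ℂ[X]) : Prop where
  approx_Z : (fun z : ℂ => Q.eval z * Z lam b M z - Phat.eval z)
    =O[Bornology.cobounded ℂ] fun z => z ^ (-1 : ℤ)
  approx_W : (fun z : ℂ => Q.eval z * W lam b z - P.eval z)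
    =O[Bornology.cobounded ℂ] fun _ => (1 : ℂ)
  symmetry : (fun z : ℂ => Phat.eval z + P.eval z * Wstar lam b z + Q.eval z * Zstar lam b M z)
    =O[Bornology.cobounded ℂ] fun z => z ^ (-((k : ℤ) + 1))
  Q_zero : Q.eval 0 = 0
  P_zero : P.eval 0 = 0
  Phat_zero : Phat.eval 0 = 1

/-! Laurent series at `z = ∞` with finite principal part are Laurent series in the variable
`w = 1 / z`: the coefficient of `z ^ j` in `f` is `f.coeff (-j)`. -/

/-- A polynomial in `z` as a Laurent series at `∞`. -/
def polyAtInfty (p : ℝ[X]) : LaurentSeries ℝ :=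
  aeval (HahnSeries.single (-1 : ℤ) (1 : ℝ) : LaurentSeries ℝ) p

/-- The series `1 / (z - a) = z⁻¹ + a z⁻² + a² z⁻³ + ⋯`. -/
def cauchyAtInfty (a : ℝ) : LaurentSeries ℝ :=
  HahnSeries.ofPowerSeries ℤ ℝ (PowerSeries.X * PowerSeries.mk fun j => a ^ j)

/-- The Laurent series of `W` at `∞`. -/
def WAtInfty {m : ℕ} (lam b : Fin m → ℝ) : LaurentSeries ℝ :=
  ∑ i, b i • cauchyAtInfty (lam i)

/-- The Laurent series of `Z` at `∞`. -/
def ZAtInfty {m : ℕ} (lam b : Fin m → ℝ) (M : ℝ) : LaurentSeries ℝ :=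
  -(1 / (2 * M)) • cauchyAtInfty 0 + ∑ i, cWeight lam b i • cauchyAtInfty (lam i)

/-- `Π_{≥0}`: the part of a Laurent series at `∞` with nonnegative powers of `z`. -/
def projNonneg (f : LaurentSeries ℝ) : ℝ[X] :=
  ∑ j ∈ Finset.range ((-f.order).toNat + 1), monomial j (f.coeff (-(j : ℤ)))

/-- `Π_{>0} = Π_{≥0} - Π⁰`: the part with positive powers of `z`. -/
def projPos (f : LaurentSeries ℝ) : ℝ[X] := projNonneg f - C (f.coeff 0)

/-- The polynomial `(Q(z) - Q(a)) / (z - a)` in `z`. -/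
def diffQuot (Q : ℝ[X]) (a : ℝ) : ℝ[X] := (Q - C (Q.eval a)) /ₘ (X - C a)

end CubicString

end

/-! Condition 1 forces `Phat` to be the polynomial part of `Q Z`, and `P` that of `Q W` up to a
constant, which `P(0) = 0` fixes. With `Q = z R`, what remains is a condition on `R` alone.

The link is the identity `Z + Z* + W W* = 0` (`Z_add_Zstar_add_W_mul_Wstar`), for which the weights
`c i` are made. By it the left side of the symmetry condition collapses to simple fractions with
poles only at the points `-λ_j` (`remainder_eq`). Such a sum is `O(z^{-(k+1)})` exactly when its
first `k` moments vanish (`isBigO_sum_div_sub_iff`). These moments are rows `1, …, k` of the linear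
system, and `Phat(0) = 1` is row `0`; hence the equivalence `isTypeI_iff`.

Solvability and exact degrees come from positivity. A shifted bimoment matrix is a product of moment
factors around the Cauchy kernel. Applying Cauchy–Binet twice together with Cauchy's determinant
writes its determinant as a sum of nonnegative terms (`factorial_mul_det_bimoment_shift`). This
yields `A_{k+1} > 0` and, by Cramer's rule, a nonzero top coefficient of `Q`. The leading
coefficients of `P` and `Phat` are that coefficient times the total masses of `μ` and `ν`, which are
negative (for `P` when `k > 0`). -/

namespace Matrix

/-! ### Cauchy's determinant and the Cauchy–Binet formula -/

theorem det_vandermonde_succ {R : Type*} [CommRing R] {n : ℕ} (v : Fin (n + 1) → R) :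
    (vandermonde v).det =
      (∏ i : Fin n, (v i.succ - v 0)) * (vandermonde fun i : Fin n => v i.succ).det := by
  rw [det_vandermonde, det_vandermonde, Fin.prod_univ_succ]
  congr 1
  · rw [Fin.prod_Ioi_zero]
  · refine Finset.prod_congr rfl fun i _ => ?_
    rw [Fin.prod_Ioi_succ]

/-- Cauchy's determinant. -/
theorem det_cauchy {K : Type*} [Field K] : ∀ {n : ℕ} (x y : Fin n → K),
    (∀ i j, x i + y j ≠ 0) →
    (of fun i j => 1 / (x i + y j)).det =
      (vandermonde x).det * (vandermonde y).det / ∏ i, ∏ j, (x i + y j)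
  | 0, _, _, _ => by simp
  | n + 1, x, y, h => by
    -- Multiples of row `0` are subtracted to clear column `0` below the corner. The remaining minor
    -- is a smaller Cauchy matrix up to row and column scalings.
    set B : Matrix (Fin (n + 1)) (Fin (n + 1)) K := of fun i j =>
      1 / (x i + y j) - (if i = 0 then 0 else (x 0 + y 0) / (x i + y 0)) * (1 / (x 0 + y j)) with hB
    have h1 : (of fun i j => 1 / (x i + y j)).det = B.det := by
      refine det_eq_of_forall_row_eq_smul_add_const
        (fun i => if i = 0 then 0 else (x 0 + y 0) / (x i + y 0)) 0 (by simp) fun i j => ?_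
      simp [hB]
    have h2 : B.submatrix (Fin.succAbove 0) Fin.succ =
        of fun i j : Fin n => (x i.succ - x 0) / (x i.succ + y 0) *
          ((of fun i j : Fin n => (y j.succ - y 0) / (x 0 + y j.succ) *
            (of fun i j : Fin n => 1 / (x i.succ + y j.succ)) i j) i j) := by
      ext i j
      have := h i.succ 0
      have := h i.succ j.succ
      have := h 0 j.succ
      simp only [hB, submatrix_apply, of_apply, Fin.zero_succAbove, Fin.succ_ne_zero, if_false]
      field_simp
      ring
    have h3 : B.det = 1 / (x 0 + y 0) * (B.submatrix (Fin.succAbove 0) Fin.succ).det := by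
      rw [det_succ_column_zero, Fin.sum_univ_succ, Finset.sum_eq_zero, add_zero]
      · simp [hB]
      · intro i _
        have h0 : B i.succ 0 = 0 := by
          have := h i.succ 0
          have := h 0 0
          simp only [hB, of_apply, Fin.succ_ne_zero, if_false]
          field_simp
          ring
        rw [h0]; ring
    rw [h1, h3, h2, det_mul_column, det_mul_row,
      det_cauchy (fun i : Fin n => x i.succ) (fun i : Fin n => y i.succ) fun i j => h _ _,
      det_vandermonde_succ x, det_vandermonde_succ y, Fin.prod_univ_succ, Fin.prod_univ_succ]
    simp only [Finset.prod_div_distrib]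
    have e : ∏ i : Fin n, ∏ j, (x i.succ + y j) =
        (∏ i : Fin n, (x i.succ + y 0)) * ∏ i : Fin n, ∏ j : Fin n, (x i.succ + y j.succ) := by
      rw [← Finset.prod_mul_distrib]
      exact Finset.prod_congr rfl fun i _ => Fin.prod_univ_succ _
    rw [e]
    simp only [div_eq_mul_inv, mul_inv]
    ring

/-- The Cauchy–Binet formula, as a sum over all maps of the index types. -/
theorem factorial_mul_det_mul {R ι κ : Type*} [CommRing R] [Fintype ι] [DecidableEq ι]
    [Fintype κ] (A : Matrix ι κ R) (B : Matrix κ ι R) :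
    ((Fintype.card ι).factorial : R) * (A * B).det =
      ∑ f : ι → κ, (A.submatrix id f).det * (B.submatrix f id).det := by
  classical
  -- Multilinearity in the rows of `A * B`; non-injective `f` contribute zero, so no ordered subsets
  -- of indices are needed.
  have key : (A * B).det = ∑ f : ι → κ, (∏ i, A i (f i)) * (B.submatrix f id).det := by
    rw [← det_transpose]
    simp only [← det_transpose (B.submatrix _ id)]
    simp only [det_apply', transpose_apply, mul_apply, Finset.prod_univ_sum,
      Fintype.piFinset_univ, Finset.mul_sum, submatrix_apply, id]
    rw [Finset.sum_comm]
    refine Finset.sum_congr rfl fun f _ => Finset.sum_congr rfl fun σ _ => ?_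
    rw [Finset.prod_mul_distrib]
    ring
  simp only [det_apply' (A.submatrix id _), Finset.sum_mul]
  rw [Finset.sum_comm]
  -- Reindexing `f` by `σ` turns each term of the expansion of the first minor into a full copy of
  -- `det (A * B)`; this is the source of the factorial.
  have : ∀ σ : Equiv.Perm ι, ∑ f : ι → κ, ((Equiv.Perm.sign σ : ℤ) : R) *
      (∏ i, A.submatrix id f (σ i) i) * (B.submatrix f id).det = (A * B).det := by
    intro σ
    rw [key]
    refine Fintype.sum_equiv (Equiv.arrowCongr σ (Equiv.refl κ)) _ _ fun f => ?_
    have e1 : ∏ i, A i ((Equiv.arrowCongr σ (Equiv.refl κ)) f i)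
        = ∏ i, A.submatrix id f (σ i) i := by
      rw [← Equiv.prod_comp σ]; simp
    have e2 : B.submatrix f id = (B.submatrix ((Equiv.arrowCongr σ (Equiv.refl κ)) f) id).submatrix σ id := by
      ext i j; simp
    rw [e1, e2, det_permute]
    have : ((Equiv.Perm.sign σ : ℤ) : R) * ((Equiv.Perm.sign σ : ℤ) : R) = 1 := by
      rw [← Int.cast_mul, Int.units_coe_mul_self, Int.cast_one]
    linear_combination ((∏ i, A.submatrix id f (σ i) i) * (B.submatrix ((Equiv.arrowCongr σ (Equiv.refl κ)) f) id).det) * this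
  rw [Finset.sum_congr rfl fun σ _ => this σ, Finset.sum_const, Finset.card_univ,
    Fintype.card_perm, nsmul_eq_mul]

end Matrix

/-! ### Positivity of the bimoment determinants -/

namespace CubicString

variable {m : ℕ} {lam b : Fin m → ℝ}

/-- The factor `λ_p ^ (i + a) b_p` of a shifted bimoment matrix. -/
noncomputable def momentFactor (lam b : Fin m → ℝ) (k a : ℕ) : Matrix (Fin m) (Fin k) ℝ :=
  Matrix.of fun p i => (lam p ^ a * b p) * lam p ^ (i : ℕ)

/-- The Cauchy kernel `1 / (κ + λ)` at the nodes. -/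
noncomputable def cauchyKernel (lam : Fin m → ℝ) : Matrix (Fin m) (Fin m) ℝ :=
  Matrix.of fun p q => 1 / (lam p + lam q)

theorem bimoment_shift_eq (k a c : ℕ) :
    (Matrix.of fun i j : Fin k => bimoment lam b (i + a) (j + c)) =
      (momentFactor lam b k a).transpose * (cauchyKernel lam * momentFactor lam b k c) := by
  ext i j
  simp only [Matrix.mul_apply, Matrix.of_apply, bimoment, momentFactor, cauchyKernel,
    Matrix.transpose_apply, Finset.mul_sum]
  refine Finset.sum_congr rfl fun p _ => Finset.sum_congr rfl fun q _ => ?_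
  ring

theorem det_momentFactor_submatrix (k a : ℕ) (f : Fin k → Fin m) :
    ((momentFactor lam b k a).submatrix f id).det =
      (∏ i, lam (f i) ^ a * b (f i)) * (Matrix.vandermonde fun i => lam (f i)).det := by
  rw [← Matrix.det_mul_column]
  rfl

theorem factorial_mul_det_bimoment_shift (hpos : ∀ i, 0 < lam i) (k a c : ℕ) :
    (k.factorial : ℝ) * (k.factorial *
      (Matrix.of fun i j : Fin k => bimoment lam b (i + a) (j + c)).det) =
    ∑ f : Fin k → Fin m, ∑ g : Fin k → Fin m,
      (∏ i, lam (f i) ^ a * (lam (g i) ^ c * (b (f i) * b (g i)))) *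
        (((Matrix.vandermonde fun i => lam (f i)).det *
          (Matrix.vandermonde fun i => lam (g i)).det) ^ 2 /
          ∏ i, ∏ j, (lam (f i) + lam (g j))) := by
  have h1 := Matrix.factorial_mul_det_mul (momentFactor lam b k a).transpose
    (cauchyKernel lam * momentFactor lam b k c)
  rw [Fintype.card_fin, ← bimoment_shift_eq] at h1
  rw [h1, Finset.mul_sum]
  refine Finset.sum_congr rfl fun f _ => ?_
  have h2 := Matrix.factorial_mul_det_mul ((cauchyKernel lam).submatrix f id)
    (momentFactor lam b k c)
  rw [Fintype.card_fin] at h2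
  have h3 : (cauchyKernel lam * momentFactor lam b k c).submatrix f id =
    (cauchyKernel lam).submatrix f id * momentFactor lam b k c := rfl
  rw [h3, mul_left_comm, h2, Finset.mul_sum]
  refine Finset.sum_congr rfl fun g _ => ?_
  have h4 : ((cauchyKernel lam).submatrix f id).submatrix id g =
    Matrix.of fun i j => 1 / (lam (f i) + lam (g j)) := rfl
  have h5 : (momentFactor lam b k a).transpose.submatrix id f =
    ((momentFactor lam b k a).submatrix f id).transpose := rfl
  rw [h4, h5, Matrix.det_transpose, det_momentFactor_submatrix, det_momentFactor_submatrix,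
    Matrix.det_cauchy _ _ fun i j => (add_pos (hpos _) (hpos _)).ne']
  simp only [Finset.prod_mul_distrib]
  ring

/-- The weights enter only in pairs `b (f i) * b (g i)`, so their negative signs cancel. -/
theorem bimoment_term_nonneg (hpos : ∀ i, 0 < lam i) (hb : ∀ i, b i < 0) {k : ℕ} (a c : ℕ)
    (f g : Fin k → Fin m) :
    0 ≤ (∏ i, lam (f i) ^ a * (lam (g i) ^ c * (b (f i) * b (g i)))) *
        (((Matrix.vandermonde fun i => lam (f i)).det *
          (Matrix.vandermonde fun i => lam (g i)).det) ^ 2 /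
          ∏ i, ∏ j, (lam (f i) + lam (g j))) := by
  refine mul_nonneg (Finset.prod_nonneg fun i _ => ?_) (div_nonneg (sq_nonneg _)
    (Finset.prod_nonneg fun i _ => Finset.prod_nonneg fun j _ => (add_pos (hpos _) (hpos _)).le))
  have := hpos (f i)
  have := hpos (g i)
  have := mul_pos_of_neg_of_neg (hb (f i)) (hb (g i))
  positivity

theorem det_bimoment_shift_nonneg (hpos : ∀ i, 0 < lam i) (hb : ∀ i, b i < 0) (k a c : ℕ) :
    0 ≤ (Matrix.of fun i j : Fin k => bimoment lam b (i + a) (j + c)).det := by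
  have h := factorial_mul_det_bimoment_shift (b := b) hpos k a c
  have hk : (0 : ℝ) < k.factorial := by positivity
  refine nonneg_of_mul_nonneg_right (nonneg_of_mul_nonneg_right (h ▸ ?_) hk) hk
  exact Finset.sum_nonneg fun f _ => Finset.sum_nonneg fun g _ =>
    bimoment_term_nonneg hpos hb a c f g

theorem det_bimoment_shift_pos (hpos : ∀ i, 0 < lam i) (hinj : Function.Injective lam)
    (hb : ∀ i, b i < 0) {k : ℕ} (hk : k ≤ m) (a c : ℕ) :
    0 < (Matrix.of fun i j : Fin k => bimoment lam b (i + a) (j + c)).det := by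
  have h := factorial_mul_det_bimoment_shift (b := b) hpos k a c
  have hk' : (0 : ℝ) < k.factorial := by positivity
  refine pos_of_mul_pos_right (pos_of_mul_pos_right (h ▸ ?_) hk'.le) hk'.le
  refine Finset.sum_pos' (fun f _ => Finset.sum_nonneg fun g _ =>
    -- Taking `f = g` to be the first `k` nodes gives a strictly positive term, because the nodes
    -- are distinct.
    bimoment_term_nonneg hpos hb a c f g) ⟨Fin.castLE hk, Finset.mem_univ _, ?_⟩
  refine Finset.sum_pos' (fun g _ => bimoment_term_nonneg hpos hb a c _ g)
    ⟨Fin.castLE hk, Finset.mem_univ _, ?_⟩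
  have hV : (Matrix.vandermonde fun i => lam (Fin.castLE hk i)).det ≠ 0 :=
    Matrix.det_vandermonde_ne_zero_iff.2 (hinj.comp (Fin.castLE_injective hk))
  refine mul_pos (Finset.prod_pos fun i _ => ?_) (div_pos (by positivity)
    (Finset.prod_pos fun i _ => Finset.prod_pos fun j _ => add_pos (hpos _) (hpos _)))
  have := hpos (Fin.castLE hk i)
  have := mul_pos_of_neg_of_neg (hb (Fin.castLE hk i)) (hb (Fin.castLE hk i))
  positivity

/-- The determinant is linear in row `0`, which is that of the bimoment matrix plus a multiple of
the first unit vector. -/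
theorem detA_succ_eq (lam b : Fin m → ℝ) (M : ℝ) (k : ℕ) :
    detA lam b M (k + 1) = detB lam b (k + 1) + detC lam b k / (2 * M) := by
  set B := Matrix.of fun i j : Fin (k + 1) => bimoment lam b i j
  have h1 : matA lam b M (k + 1) =
      B.updateRow 0 (B 0 + (1 / (2 * M)) • Pi.single (0 : Fin (k + 1)) (1 : ℝ)) := by
    ext i j
    rcases Fin.eq_zero_or_eq_succ i with rfl | ⟨i, rfl⟩
    · rcases Fin.eq_zero_or_eq_succ j with rfl | ⟨j, rfl⟩ <;> simp [matA, B]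
    · simp [matA, B, Matrix.updateRow_ne]
  have h2 : (B.updateRow 0 (Pi.single (0 : Fin (k + 1)) (1 : ℝ))).det = detC lam b k := by
    rw [← Matrix.adjugate_apply, Matrix.adjugate_fin_succ_eq_det_submatrix]
    simp only [Fin.val_zero, add_zero, pow_zero, one_mul, Fin.succAbove_zero, detC]
    rfl
  rw [detA, h1, Matrix.det_updateRow_add, Matrix.det_updateRow_smul, h2,
    Matrix.updateRow_eq_self, detB]
  ring

theorem detA_succ_pos (hpos : ∀ i, 0 < lam i) (hinj : Function.Injective lam)
    (hb : ∀ i, b i < 0) {M : ℝ} (hM : 0 < M) {k : ℕ} (hk : k ≤ m) :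
    0 < detA lam b M (k + 1) := by
  rw [detA_succ_eq]
  -- Only nonnegativity is available: for `k = m` this determinant has more rows than there are
  -- nodes and vanishes.
  have h1 : 0 ≤ detB lam b (k + 1) := det_bimoment_shift_nonneg hpos hb (k + 1) 0 0
  have h2 : 0 < detC lam b k := det_bimoment_shift_pos hpos hinj hb hk 1 1
  positivity

/-- By Cramer's rule the last unknown is, up to sign and the factor `1 / det`, the minor without row
`0` and the last column. Removing row `0` discards the entry containing `M`, leaving a positive
shifted bimoment determinant. -/
theorem mulVec_matA_last_ne_zero (hpos : ∀ i, 0 < lam i) (hinj : Function.Injective lam)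
    (hb : ∀ i, b i < 0) {M : ℝ} {k : ℕ} (hk : k ≤ m) {q : Fin (k + 1) → ℝ}
    (hq : (matA lam b M (k + 1)).mulVec q = -Pi.single 0 1) : q (Fin.last k) ≠ 0 := by
  intro h0
  have h1 := congrArg (fun v => (matA lam b M (k + 1)).adjugate.mulVec v (Fin.last k)) hq
  simp only [Matrix.mulVec_mulVec, Matrix.adjugate_mul, Matrix.smul_mulVec, Matrix.one_mulVec,
    Pi.smul_apply, h0, smul_zero, Matrix.mulVec_neg, Pi.neg_apply, Matrix.mulVec_single_one,
    Matrix.col_apply] at h1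
  rw [Matrix.adjugate_fin_succ_eq_det_submatrix] at h1
  have h2 : (matA lam b M (k + 1)).submatrix (Fin.succAbove 0) (Fin.succAbove (Fin.last k)) =
      Matrix.of fun i j : Fin k => bimoment lam b (i + 1) (j + 0) := by
    ext i j
    simp [matA]
  rw [h2] at h1
  have h3 := det_bimoment_shift_pos hpos hinj hb hk 1 0
  simp only [neg_eq_zero, zero_eq_neg, mul_eq_zero, pow_eq_zero_iff', one_ne_zero,
    false_and, false_or] at h1
  simp at h1
  exact h3.ne' h1

end CubicString

/-! ### Polynomial parts of products with sums of simple fractions -/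

namespace CubicString

section Field

variable {K ι : Type*} [Field K] [Fintype ι]

/-- The polynomial part `∑ i, w i (Q(z) - Q(a i)) / (z - a i)` of `Q(z) ∑ i, w i / (z - a i)`. -/
noncomputable def cauchyPart (w a : ι → K) (Q : K[X]) : K[X] :=
  ∑ i, C (w i) * (Q /ₘ (X - C (a i)))

theorem X_sub_C_mul_divByMonic_add (Q : K[X]) (a : K) :
    (X - C a) * (Q /ₘ (X - C a)) + C (Q.eval a) = Q := by
  rw [add_comm, ← modByMonic_X_sub_C_eq_C_eval]
  exact modByMonic_add_div Q (X - C a)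

theorem eval_mul_sum_div_sub {w a : ι → K} (Q : K[X]) {z : K} (hz : ∀ i, z - a i ≠ 0) :
    Q.eval z * ∑ i, w i / (z - a i) =
      (cauchyPart w a Q).eval z + ∑ i, w i * Q.eval (a i) / (z - a i) := by
  rw [cauchyPart, eval_finsetSum, Finset.mul_sum, ← Finset.sum_add_distrib]
  refine Finset.sum_congr rfl fun i _ => ?_
  have h := congrArg (eval z) (X_sub_C_mul_divByMonic_add Q (a i))
  simp only [eval_add, eval_mul, eval_sub, eval_X, eval_C] at h ⊢
  have := hz i
  field_simp
  linear_combination -w i * h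

theorem natDegree_cauchyPart_le (w a : ι → K) {Q : K[X]} {k : ℕ} (hQ : Q.natDegree ≤ k + 1) :
    (cauchyPart w a Q).natDegree ≤ k := by
  refine natDegree_sum_le_of_forall_le _ _ fun i _ => (natDegree_C_mul_le _ _).trans ?_
  rw [natDegree_divByMonic _ (monic_X_sub_C _), natDegree_X_sub_C]
  omega

/-- Each quotient by `X - C (a i)` inherits the top coefficient of `Q`. This gives the exact degrees
of `P` and `Phat`. -/
theorem coeff_cauchyPart (w a : ι → K) {Q : K[X]} {k : ℕ} (hQ : Q.natDegree ≤ k + 1) :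
    (cauchyPart w a Q).coeff k = (∑ i, w i) * Q.coeff (k + 1) := by
  rw [cauchyPart, finsetSum_coeff, Finset.sum_mul]
  refine Finset.sum_congr rfl fun i _ => ?_
  rw [coeff_C_mul, coeff_divByMonic_X_sub_C_rec, mul_add,
    coeff_eq_zero_of_natDegree_lt (p := Q /ₘ (X - C (a i))), mul_zero, mul_zero, add_zero]
  rw [natDegree_divByMonic _ (monic_X_sub_C _), natDegree_X_sub_C]
  omega

/-- At `z = 0` the quotient `(z R(z) - a R(a)) / (z - a)` equals `R(a)`. The case `a = 0` is needed
for the atom of `ν` at the origin. -/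
theorem eval_zero_X_mul_divByMonic (R : K[X]) (a : K) :
    ((X * R) /ₘ (X - C a)).eval 0 = R.eval a := by
  rcases eq_or_ne a 0 with rfl | ha
  · have h := mul_divByMonic_cancel_left R (monic_X (R := K))
    rw [C_0, sub_zero, h]
  · have h := congrArg (eval 0) (X_sub_C_mul_divByMonic_add (X * R) a)
    simp only [eval_add, eval_mul, eval_sub, eval_X, eval_C, zero_mul, zero_sub] at h
    refine mul_left_cancel₀ ha ?_
    linear_combination -h

theorem eval_zero_cauchyPart_X_mul (w a : ι → K) (R : K[X]) :
    (cauchyPart w a (X * R)).eval 0 = ∑ i, w i * R.eval (a i) := by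
  simp [cauchyPart, eval_finsetSum, eval_zero_X_mul_divByMonic]

theorem map_cauchyPart {L : Type*} [Field L] (φ : K →+* L) (w a : ι → K) (Q : K[X]) :
    (cauchyPart w a Q).map φ = cauchyPart (fun i => φ (w i)) (fun i => φ (a i)) (Q.map φ) := by
  simp [cauchyPart, Polynomial.map_sum, map_divByMonic _ (monic_X_sub_C _)]

end Field

theorem diffQuot_eq (Q : ℝ[X]) (a : ℝ) : diffQuot Q a = Q /ₘ (X - C a) := by
  have h : Q - C (Q.eval a) = (X - C a) * (Q /ₘ (X - C a)) := by
    linear_combination -X_sub_C_mul_divByMonic_add Q a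
  rw [diffQuot, h, mul_divByMonic_cancel_left _ (monic_X_sub_C a)]

/-! ### Laurent series at infinity -/

theorem coeff_projNonneg (f : LaurentSeries ℝ) (j : ℕ) :
    (projNonneg f).coeff j = f.coeff (-(j : ℤ)) := by
  simp only [projNonneg, finsetSum_coeff, coeff_monomial]
  rw [Finset.sum_ite_eq']
  split_ifs with h
  · rfl
  · refine (HahnSeries.coeff_eq_zero_of_lt_order ?_).symm
    rw [Finset.mem_range] at h
    omega

theorem algebraMap_laurentSeries (a : ℝ) :
    algebraMap ℝ (LaurentSeries ℝ) a = HahnSeries.C a := by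
  rw [HahnSeries.algebraMap_apply']
  exact HahnSeries.ofPowerSeries_C a

theorem coeff_polyAtInfty (p : ℝ[X]) (j : ℕ) :
    (polyAtInfty p).coeff (-(j : ℤ)) = p.coeff j := by
  induction p using Polynomial.induction_on' with
  | add p q hp hq => rw [polyAtInfty, map_add, HahnSeries.coeff_add, coeff_add, ← hp, ← hq]; rfl
  | monomial n a =>
    rw [polyAtInfty, aeval_monomial, HahnSeries.single_pow, algebraMap_laurentSeries,
      HahnSeries.C_mul_eq_smul,
      HahnSeries.coeff_smul, HahnSeries.coeff_single, coeff_monomial]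
    simp [eq_comm]

theorem coeff_cauchyAtInfty (a : ℝ) (j : ℕ) : (cauchyAtInfty a).coeff (-(j : ℤ)) = 0 := by
  rw [cauchyAtInfty, PowerSeries.coeff_coe]
  rcases j with _ | j
  · simp
  · rw [if_pos (by omega)]

theorem cauchyAtInfty_mul_polyAtInfty_X_sub_C (a : ℝ) :
    cauchyAtInfty a * polyAtInfty (X - C a) = 1 := by
  set G : PowerSeries ℝ := PowerSeries.mk fun j => a ^ j
  have hG : G * (1 - PowerSeries.C a * PowerSeries.X) = 1 := by
    ext n
    rcases n with _ | n
    · simp [G]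
    · rw [mul_sub, mul_one, mul_left_comm, map_sub, PowerSeries.coeff_C_mul,
        PowerSeries.coeff_succ_mul_X]
      simp [G, PowerSeries.coeff_one, pow_succ']
  have hX : HahnSeries.ofPowerSeries ℤ ℝ PowerSeries.X * HahnSeries.single (-1 : ℤ) (1 : ℝ) = 1 := by
    simp [HahnSeries.ofPowerSeries_X]
  have h := congrArg (HahnSeries.ofPowerSeries ℤ ℝ) hG
  simp only [map_mul, map_sub, map_one, HahnSeries.ofPowerSeries_C] at h
  rw [cauchyAtInfty, polyAtInfty, map_sub, aeval_X, aeval_C, map_mul]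
  rw [algebraMap_laurentSeries]
  linear_combination h + (HahnSeries.ofPowerSeries ℤ ℝ G) * hX

/-- Formal counterpart of `eval_mul_sum_div_sub`: the last term has only negative powers, so the
projection keeps just the quotient. -/
theorem cauchyAtInfty_mul_polyAtInfty (a : ℝ) (Q : ℝ[X]) :
    cauchyAtInfty a * polyAtInfty Q =
      polyAtInfty (Q /ₘ (X - C a)) + Q.eval a • cauchyAtInfty a := by
  have h : polyAtInfty Q = polyAtInfty (X - C a) * polyAtInfty (Q /ₘ (X - C a)) +
      HahnSeries.C (Q.eval a) := by
    conv_lhs => rw [← X_sub_C_mul_divByMonic_add Q a]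
    rw [polyAtInfty, map_add, map_mul, aeval_C, algebraMap_laurentSeries]
    rfl
  rw [h, ← HahnSeries.C_mul_eq_smul]
  linear_combination polyAtInfty (Q /ₘ (X - C a)) * cauchyAtInfty_mul_polyAtInfty_X_sub_C a

theorem projNonneg_sum_cauchyAtInfty {ι : Type*} [Fintype ι] (w a : ι → ℝ) (Q : ℝ[X]) :
    projNonneg ((∑ i, w i • cauchyAtInfty (a i)) * polyAtInfty Q) = cauchyPart w a Q := by
  ext j
  rw [coeff_projNonneg, Finset.sum_mul, HahnSeries.coeff_sum, cauchyPart, finsetSum_coeff]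
  refine Finset.sum_congr rfl fun i _ => ?_
  rw [← HahnSeries.C_mul_eq_smul, mul_assoc, HahnSeries.C_mul_eq_smul, cauchyAtInfty_mul_polyAtInfty, HahnSeries.coeff_smul, HahnSeries.coeff_add,
    HahnSeries.coeff_smul, coeff_polyAtInfty, coeff_cauchyAtInfty, coeff_C_mul, smul_zero, add_zero,
    smul_eq_mul]

end CubicString

/-! ### Asymptotics at infinity -/

namespace CubicString

open Asymptotics Bornology Filter

theorem isBigO_const_div_sub (c a : ℂ) :
    (fun z : ℂ => c / (z - a)) =O[cobounded ℂ] fun z => z ^ (-1 : ℤ) := by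
  have h1 : (fun z : ℂ => z) =O[cobounded ℂ] fun z => z - a := by
    have h := isBigO_cobounded_of_degree_le (P := (X : ℂ[X])) (Q := X - C a)
      (by rw [degree_X, degree_X_sub_C])
    simpa using h
  have h2 := h1.inv_rev ((eventually_ne_cobounded (0 : ℂ)).mono fun _ hz h0 => absurd h0 hz)
  simpa [div_eq_mul_inv] using h2.const_mul_left c

theorem isBigO_sum_div_sub {ι : Type*} [Fintype ι] (g a : ι → ℂ) :
    (fun z : ℂ => ∑ i, g i / (z - a i)) =O[cobounded ℂ] fun z => z ^ (-1 : ℤ) :=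
  IsBigO.fun_sum fun i _ => isBigO_const_div_sub (g i) (a i)

theorem tendsto_zpow_neg_one_cobounded :
    Tendsto (fun z : ℂ => z ^ (-1 : ℤ)) (cobounded ℂ) (nhds 0) := by
  simpa using tendsto_inv₀_cobounded (α := ℂ)

theorem isBigO_zpow_neg_one_one :
    (fun z : ℂ => z ^ (-1 : ℤ)) =O[cobounded ℂ] fun _ => (1 : ℂ) :=
  tendsto_zpow_neg_one_cobounded.isBigO_one ℂ

theorem eventually_forall_sub_ne_zero {ι : Type*} [Finite ι] (a : ι → ℂ) :
    ∀ᶠ z in cobounded ℂ, ∀ i, z - a i ≠ 0 :=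
  eventually_all.2 fun i => (eventually_ne_cobounded (a i)).mono fun _ h => sub_ne_zero.2 h

theorem natDegree_eq_zero_of_isBigO_one {p : ℂ[X]}
    (h : (fun z => p.eval z) =O[cobounded ℂ] fun _ => (1 : ℂ)) : p.natDegree = 0 := by
  by_contra hp
  have ht : Tendsto (fun z : ℂ => ‖p.eval z‖) (cobounded ℂ) atTop :=
    p.tendsto_norm_atTop (natDegree_pos_iff_degree_pos.1 (Nat.pos_of_ne_zero hp))
      tendsto_norm_cobounded_atTop
  exact not_isBoundedUnder_of_tendsto_atTop ht ((isBigO_one_iff ℂ).1 h)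

theorem eq_zero_of_isBigO_inv {p : ℂ[X]}
    (h : (fun z => p.eval z) =O[cobounded ℂ] fun z => z ^ (-1 : ℤ)) : p = 0 := by
  have h0 := eq_C_of_natDegree_eq_zero
    (natDegree_eq_zero_of_isBigO_one (h.trans isBigO_zpow_neg_one_one))
  have ht := h.trans_tendsto tendsto_zpow_neg_one_cobounded
  rw [h0] at ht
  simp only [eval_C] at ht
  rw [h0, tendsto_const_nhds_iff.1 ht, C_0]

theorem isBigO_zpow_neg_succ_iff (f : ℂ → ℂ) (k : ℕ) :
    f =O[cobounded ℂ] (fun z => z ^ (-((k : ℤ) + 1))) ↔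
      (fun z => z ^ k * f z) =O[cobounded ℂ] fun z => z ^ (-1 : ℤ) := by
  have e1 : (fun z : ℂ => z ^ k * z ^ (-((k : ℤ) + 1))) =ᶠ[cobounded ℂ] fun z => z ^ (-1 : ℤ) := by
    filter_upwards [eventually_ne_cobounded (0 : ℂ)] with z hz
    rw [← zpow_natCast, ← zpow_add₀ hz]
    congr 1
    ring
  have e2 : (fun z : ℂ => (z ^ k)⁻¹ * z ^ (-1 : ℤ)) =ᶠ[cobounded ℂ]
      fun z => z ^ (-((k : ℤ) + 1)) := by
    filter_upwards [eventually_ne_cobounded (0 : ℂ)] with z hz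
    rw [← zpow_natCast, ← zpow_neg, ← zpow_add₀ hz]
    congr 1
    ring
  have e3 : (fun z : ℂ => (z ^ k)⁻¹ * (z ^ k * f z)) =ᶠ[cobounded ℂ] f := by
    filter_upwards [eventually_ne_cobounded (0 : ℂ)] with z hz
    rw [inv_mul_cancel_left₀ (pow_ne_zero k hz)]
  exact ⟨fun h => ((isBigO_refl (fun z : ℂ => z ^ k) _).mul h).congr' EventuallyEq.rfl e1,
    fun h => ((isBigO_refl (fun z : ℂ => (z ^ k)⁻¹) _).mul h).congr' e3 e2⟩

theorem coeff_cauchyPart_X_pow {ι : Type*} [Fintype ι] (g a : ι → ℂ) {k l : ℕ} (hl : l < k) :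
    (cauchyPart g a (X ^ k)).coeff (k - 1 - l) = ∑ i, g i * a i ^ l := by
  rw [cauchyPart, finsetSum_coeff]
  refine Finset.sum_congr rfl fun i _ => ?_
  rw [coeff_C_mul, coeff_divByMonic_X_sub_C, natDegree_X_pow, Finset.sum_eq_single k]
  · rw [coeff_X_pow_self, mul_one]
    congr 2
    omega
  · intro j _ hj
    rw [coeff_X_pow, if_neg hj, mul_zero]
  · intro h
    rw [Finset.mem_Icc] at h
    omega

/-- The order of vanishing at infinity of a sum of simple fractions is read off its moments. -/
theorem isBigO_sum_div_sub_iff {ι : Type*} [Fintype ι] (g a : ι → ℂ) (k : ℕ) :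
    (fun z : ℂ => ∑ i, g i / (z - a i)) =O[cobounded ℂ] (fun z => z ^ (-((k : ℤ) + 1))) ↔
      ∀ l < k, ∑ i, g i * a i ^ l = 0 := by
  -- After multiplication by `z ^ k` the sum is a polynomial plus `O(1/z)`, so the polynomial, whose
  -- coefficients are the moments, must vanish.
  have key : (fun z : ℂ => ∑ i, g i / (z - a i)) =O[cobounded ℂ] (fun z => z ^ (-((k : ℤ) + 1))) ↔
      cauchyPart g a (X ^ k) = 0 := by
    rw [isBigO_zpow_neg_succ_iff]
    have e : (fun z : ℂ => z ^ k * ∑ i, g i / (z - a i)) =ᶠ[cobounded ℂ] fun z =>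
        (cauchyPart g a (X ^ k)).eval z + ∑ i, (g i * a i ^ k) / (z - a i) := by
      filter_upwards [eventually_forall_sub_ne_zero a] with z hz
      simpa using eval_mul_sum_div_sub (w := g) (X ^ k) hz
    rw [isBigO_congr e EventuallyEq.rfl]
    have hO := isBigO_sum_div_sub (fun i => g i * a i ^ k) a
    refine ⟨fun h => eq_zero_of_isBigO_inv ?_, fun h => ?_⟩
    · simpa using h.sub hO
    · simpa [h] using hO
  rw [key]
  refine ⟨fun h l hl => ?_, fun h => ?_⟩
  · rw [← coeff_cauchyPart_X_pow g a hl, h, coeff_zero]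
  · ext n
    rw [coeff_zero]
    rcases lt_or_ge n k with hn | hn
    · have := coeff_cauchyPart_X_pow g a (k := k) (l := k - 1 - n) (by omega)
      rw [show k - 1 - (k - 1 - n) = n by omega] at this
      rw [this, h _ (by omega)]
    -- For `k = 0` the quotients of `1` vanish outright; the degree bound applies only to exponents
    -- of the form `k + 1`.
    · rcases k with _ | k
      · have h1 : ∀ i, (1 : ℂ[X]) /ₘ (X - C (a i)) = 0 := fun i =>
          (divByMonic_eq_zero_iff (monic_X_sub_C _)).2 (by
            rw [degree_one, degree_X_sub_C]; exact zero_lt_one)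
        simp [cauchyPart, h1]
      · exact coeff_eq_zero_of_natDegree_lt
          (((natDegree_cauchyPart_le g a (by rw [natDegree_X_pow])).trans_lt hn))

/-! ### The remainder in the symmetry condition -/

variable {m : ℕ} (lam b : Fin m → ℝ) (M : ℝ)

/-- The nodes of the measure `ν`. -/
def nuNode : Fin (m + 1) → ℝ := Fin.cons 0 lam

/-- The weights of the measure `ν`. -/
noncomputable def nuWeight : Fin (m + 1) → ℝ := Fin.cons (-(1 / (2 * M))) (cWeight lam b)

/-- The polynomial `Π_{>0}(W Q)` over `ℂ`. -/
noncomputable def polyP (Q : ℂ[X]) : ℂ[X] :=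
  cauchyPart (fun i => (b i : ℂ)) (fun i => (lam i : ℂ)) Q -
    C ((cauchyPart (fun i => (b i : ℂ)) (fun i => (lam i : ℂ)) Q).eval 0)

/-- The polynomial `Π_{≥0}(Z Q)` over `ℂ`. -/
noncomputable def polyPhat (Q : ℂ[X]) : ℂ[X] :=
  cauchyPart (fun i => (nuWeight lam b M i : ℂ)) (fun i => (nuNode lam i : ℂ)) Q

theorem Z_eq (z : ℂ) :
    Z lam b M z = ∑ i, (nuWeight lam b M i : ℂ) / (z - (nuNode lam i : ℂ)) := by
  simp [Z, nuWeight, nuNode, Fin.sum_univ_succ]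

variable {lam b M}

/-- The weight at `-λ_j` of the remainder in the symmetry condition, for `Q = X * R`. -/
noncomputable def remainderWeight (lam b : Fin m → ℝ) (R : ℂ[X]) (j : Fin m) : ℂ :=
  b j * lam j * ∑ i, R.eval (lam i : ℂ) * b i / (lam j + lam i)

/-- Partial fractions split `1 / ((z - λ_i)(z + λ_j))` with factor `1 / (λ_i + λ_j)`, and summation
produces exactly the `c i`. The pole of `Z` at `0` is odd and cancels against that of `Z*`. -/
theorem Z_add_Zstar_add_W_mul_Wstar (hpos : ∀ i, 0 < lam i) {z : ℂ}
    (h1 : ∀ i, z - (lam i : ℂ) ≠ 0) (h2 : ∀ i, z + (lam i : ℂ) ≠ 0) :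
    Z lam b M z + Zstar lam b M z + W lam b z * Wstar lam b z = 0 := by
  have hs : ∀ i j, (lam i : ℂ) + lam j ≠ 0 := fun i j => by
    exact_mod_cast (add_pos (hpos i) (hpos j)).ne'
  have hW : W lam b z * Wstar lam b z =
      ∑ i, ∑ j, (b i * b j / (lam i + lam j) * (1 / (z - lam i)) -
        b i * b j / (lam i + lam j) * (1 / (z + lam j)) : ℂ) := by
    rw [Wstar, W, W, ← Finset.sum_neg_distrib, Finset.sum_mul_sum]
    refine Finset.sum_congr rfl fun i _ => Finset.sum_congr rfl fun j _ => ?_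
    have := hs i j
    have := h1 i
    have := h2 j
    rw [show -z - (lam j : ℂ) = -(z + lam j) by ring, div_neg, neg_neg]
    field_simp
    ring
  have hZ : Z lam b M z + Zstar lam b M z =
      ∑ i, (cWeight lam b i * (1 / (z - lam i)) : ℂ) -
        ∑ i, (cWeight lam b i * (1 / (z + lam i)) : ℂ) := by
    have e : ∀ i, (cWeight lam b i : ℂ) / (-z - lam i) = -(cWeight lam b i * (1 / (z + lam i))) :=
      fun i => by rw [show -z - (lam i : ℂ) = -(z + lam i) by ring, div_neg, mul_one_div]
    simp only [Z, Zstar, e, Finset.sum_neg_distrib, mul_one_div]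
    rw [div_neg]
    ring
  have c1 : ∑ i, (cWeight lam b i * (1 / (z - lam i)) : ℂ) =
      -∑ i, ∑ j, (b i * b j / (lam i + lam j) * (1 / (z - lam i)) : ℂ) := by
    rw [← Finset.sum_neg_distrib]
    refine Finset.sum_congr rfl fun i _ => ?_
    rw [cWeight]
    push_cast
    rw [neg_mul, Finset.sum_mul]
    refine congrArg _ (Finset.sum_congr rfl fun j _ => ?_)
    rw [mul_comm (b j : ℂ), add_comm (lam j : ℂ)]
  have c2 : ∑ i, (cWeight lam b i * (1 / (z + lam i)) : ℂ) =
      -∑ i, ∑ j, (b i * b j / (lam i + lam j) * (1 / (z + lam j)) : ℂ) := by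
    rw [Finset.sum_comm, ← Finset.sum_neg_distrib]
    refine Finset.sum_congr rfl fun i _ => ?_
    rw [cWeight]
    push_cast
    rw [neg_mul, Finset.sum_mul]
  rw [hZ, hW, c1, c2]
  simp only [Finset.sum_sub_distrib]
  ring

/-- Replacing `Q Z` and `Q W` by their polynomial parts in `Q (Z + Z* + W W*) = 0` leaves only the
discarded fractions. Their poles at `λ_i` cancel, since `λ_i (z + λ_j) - z (λ_i + λ_j) = -λ_j (z -
λ_i)`. The resulting factor `λ_j` makes the moment conditions start at row `1`. -/
theorem remainder_eq (hpos : ∀ i, 0 < lam i) (R : ℂ[X]) {z : ℂ} (h0 : z ≠ 0)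
    (h1 : ∀ i, z - (lam i : ℂ) ≠ 0) (h2 : ∀ i, z + (lam i : ℂ) ≠ 0) :
    (polyPhat lam b M (X * R)).eval z + (polyP lam b (X * R)).eval z * Wstar lam b z +
      (X * R).eval z * Zstar lam b M z = -∑ j, remainderWeight lam b R j / (z + lam j) := by
  have hs : ∀ i j, (lam i : ℂ) + lam j ≠ 0 := fun i j => by
    exact_mod_cast (add_pos (hpos i) (hpos j)).ne'
  have eP := eval_mul_sum_div_sub (w := fun i => (b i : ℂ)) (X * R) h1
  have ePh := eval_mul_sum_div_sub (w := fun i => (nuWeight lam b M i : ℂ)) (X * R)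
    (a := fun i => (nuNode lam i : ℂ)) (z := z) (fun i => by
      refine Fin.cases ?_ (fun i => ?_) i
      · simpa [nuNode] using h0
      · simpa [nuNode] using h1 i)
  rw [← Z_eq] at ePh
  change _ * W lam b z = _ at eP
  have e0 := eval_zero_cauchyPart_X_mul (fun i => (b i : ℂ)) (fun i => (lam i : ℂ)) R
  -- The constant removed from `P` turns each numerator `λ_i` into `z`.
  have hsumP : ∑ i, (b i : ℂ) * (X * R).eval (lam i : ℂ) / (z - lam i) +
      ∑ i, (b i : ℂ) * R.eval (lam i : ℂ) = ∑ i, b i * R.eval (lam i : ℂ) * z / (z - lam i) := by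
    rw [← Finset.sum_add_distrib]
    refine Finset.sum_congr rfl fun i _ => ?_
    have := h1 i
    rw [eval_mul, eval_X]
    field_simp
    ring
  -- The node `0` drops out because `Q(0) = 0`, so the remainder does not involve `M`.
  have hsumZ : ∑ i, (nuWeight lam b M i : ℂ) * (X * R).eval (nuNode lam i : ℂ) /
      (z - nuNode lam i) =
      -∑ j, ∑ i, b j * b i / (lam j + lam i) * (lam i * R.eval (lam i : ℂ)) / (z - lam i) := by
    rw [Fin.sum_univ_succ, Finset.sum_comm, ← Finset.sum_neg_distrib]
    simp only [nuWeight, nuNode, Fin.cons_zero, Fin.cons_succ, Complex.ofReal_zero, eval_mul,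
      eval_X, zero_mul, mul_zero, zero_div, zero_add]
    refine Finset.sum_congr rfl fun i _ => ?_
    rw [cWeight]
    push_cast
    rw [neg_mul, Finset.sum_mul, neg_div, Finset.sum_div]
  have hWs : Wstar lam b z = ∑ j, (b j : ℂ) / (z + lam j) := by
    rw [Wstar, W, ← Finset.sum_neg_distrib]
    refine Finset.sum_congr rfl fun j _ => ?_
    rw [show -z - (lam j : ℂ) = -(z + lam j) by ring, div_neg, neg_neg]
  have hrem : -(∑ i, (nuWeight lam b M i : ℂ) * (X * R).eval (nuNode lam i : ℂ) /
      (z - nuNode lam i)) - Wstar lam b z * ∑ i, b i * R.eval (lam i : ℂ) * z / (z - lam i) =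
      -∑ j, remainderWeight lam b R j / (z + lam j) := by
    rw [hsumZ, hWs, Finset.sum_mul_sum, neg_neg, ← Finset.sum_sub_distrib,
      ← Finset.sum_neg_distrib]
    refine Finset.sum_congr rfl fun j _ => ?_
    rw [← Finset.sum_sub_distrib, remainderWeight, Finset.mul_sum, Finset.sum_div,
      ← Finset.sum_neg_distrib]
    refine Finset.sum_congr rfl fun i _ => ?_
    have := hs j i
    have := h1 i
    have := h2 j
    field_simp
    ring
  rw [polyP, polyPhat, eval_sub, eval_C, e0]
  have h3 := Z_add_Zstar_add_W_mul_Wstar (M := M) (b := b) hpos h1 h2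
  rw [← hsumP] at hrem
  linear_combination hrem + (X * R).eval z * h3 - ePh - Wstar lam b z * eP

end CubicString

/-! ### Equivalence with the linear system -/

namespace CubicString

open Asymptotics Bornology Filter

variable {m : ℕ} {lam b : Fin m → ℝ} {M : ℝ}

theorem sum_fin_coeff_mul_pow {R : ℂ[X]} {k : ℕ} (hR : R.natDegree ≤ k) (a : ℂ) :
    ∑ j : Fin (k + 1), R.coeff j * a ^ (j : ℕ) = R.eval a := by
  rw [eval_eq_sum_range' (Nat.lt_succ_of_le hR),
    Fin.sum_univ_eq_sum_range (fun j => R.coeff j * a ^ j)]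

/-- The complexified matrix of the linear system. -/
noncomputable def matAComplex (lam b : Fin m → ℝ) (M : ℝ) (k : ℕ) : Matrix (Fin k) (Fin k) ℂ :=
  (matA lam b M k).map Complex.ofRealHom

theorem sum_bimoment_mul_coeff {R : ℂ[X]} {k : ℕ} (hR : R.natDegree ≤ k) (i : ℕ) :
    ∑ j : Fin (k + 1), (bimoment lam b i j : ℂ) * R.coeff j =
      ∑ p, ∑ q, (lam p : ℂ) ^ i / (lam p + lam q) * b p * b q * R.eval (lam q : ℂ) := by
  simp only [bimoment, ← sum_fin_coeff_mul_pow hR, Finset.mul_sum, Complex.ofReal_sum,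
    Finset.sum_mul]
  rw [Finset.sum_comm]
  refine Finset.sum_congr rfl fun p _ => ?_
  rw [Finset.sum_comm]
  refine Finset.sum_congr rfl fun q _ => Finset.sum_congr rfl fun j _ => ?_
  push_cast
  ring

theorem matAComplex_mulVec_zero {R : ℂ[X]} {k : ℕ} (hR : R.natDegree ≤ k) :
    (matAComplex lam b M (k + 1)).mulVec (fun j => R.coeff j) 0 =
      -(polyPhat lam b M (X * R)).eval 0 := by
  have h1 : (matAComplex lam b M (k + 1)).mulVec (fun j => R.coeff j) 0 =
      ∑ j : Fin (k + 1), (bimoment lam b 0 j : ℂ) * R.coeff j +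
        ((1 / (2 * M) : ℝ) : ℂ) * R.coeff 0 := by
    rw [Matrix.mulVec, dotProduct, Fin.sum_univ_succ, Fin.sum_univ_succ (n := k)]
    simp [matAComplex, matA]
    ring
  rw [h1, sum_bimoment_mul_coeff hR, polyPhat, eval_zero_cauchyPart_X_mul, Fin.sum_univ_succ]
  simp only [nuWeight, nuNode, Fin.cons_zero, Fin.cons_succ, cWeight]
  rw [Finset.sum_comm, neg_add, ← Finset.sum_neg_distrib, add_comm, coeff_zero_eq_eval_zero]
  congr 1
  · simp
  · refine Finset.sum_congr rfl fun q _ => ?_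
    push_cast
    rw [neg_mul, neg_neg, Finset.sum_mul]
    refine Finset.sum_congr rfl fun p _ => ?_
    ring

theorem matAComplex_mulVec_succ {R : ℂ[X]} {k : ℕ} (hR : R.natDegree ≤ k) (i : Fin k) :
    (matAComplex lam b M (k + 1)).mulVec (fun j => R.coeff j) i.succ =
      ∑ p, remainderWeight lam b R p * (lam p : ℂ) ^ (i : ℕ) := by
  have h1 : (matAComplex lam b M (k + 1)).mulVec (fun j => R.coeff j) i.succ =
      ∑ j : Fin (k + 1), (bimoment lam b (i + 1) j : ℂ) * R.coeff j := by
    rw [Matrix.mulVec, dotProduct]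
    simp [matAComplex, matA]
  rw [h1, sum_bimoment_mul_coeff hR]
  refine Finset.sum_congr rfl fun p _ => ?_
  rw [remainderWeight, Finset.mul_sum, Finset.sum_mul]
  refine Finset.sum_congr rfl fun q _ => ?_
  ring

theorem mulVec_eq_iff {R : ℂ[X]} {k : ℕ} (hR : R.natDegree ≤ k) :
    (matAComplex lam b M (k + 1)).mulVec (fun j => R.coeff j) = -Pi.single 0 1 ↔
      (polyPhat lam b M (X * R)).eval 0 = 1 ∧
        ∀ l < k, ∑ p, remainderWeight lam b R p * (lam p : ℂ) ^ l = 0 := by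
  rw [funext_iff, Fin.forall_fin_succ, matAComplex_mulVec_zero hR]
  refine and_congr (by simp) ⟨fun h l hl => ?_, fun h i => ?_⟩
  · have := h ⟨l, hl⟩
    rw [matAComplex_mulVec_succ hR] at this
    simpa using this
  · rw [matAComplex_mulVec_succ hR, h i i.2]
    simp

theorem symmetry_iff (hpos : ∀ i, 0 < lam i) (R : ℂ[X]) (k : ℕ) :
    ((fun z : ℂ => (polyPhat lam b M (X * R)).eval z +
      (polyP lam b (X * R)).eval z * Wstar lam b z + (X * R).eval z * Zstar lam b M z)
        =O[cobounded ℂ] fun z => z ^ (-((k : ℤ) + 1))) ↔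
      ∀ l < k, ∑ p, remainderWeight lam b R p * (lam p : ℂ) ^ l = 0 := by
  have e : (fun z : ℂ => (polyPhat lam b M (X * R)).eval z +
      (polyP lam b (X * R)).eval z * Wstar lam b z + (X * R).eval z * Zstar lam b M z)
      =ᶠ[cobounded ℂ] fun z => -∑ j, remainderWeight lam b R j / (z - -(lam j : ℂ)) := by
    filter_upwards [eventually_ne_cobounded (0 : ℂ),
      eventually_forall_sub_ne_zero (fun i => (lam i : ℂ)),
      eventually_forall_sub_ne_zero (fun i => -(lam i : ℂ))] with z h0 h1 h2
    simp only [sub_neg_eq_add] at h2 ⊢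
    exact remainder_eq hpos R h0 h1 h2
  rw [isBigO_congr e EventuallyEq.rfl, isBigO_neg_left, isBigO_sum_div_sub_iff]
  refine forall₂_congr fun l _ => ?_
  -- The poles are at `-λ_p`, so each moment changes only by a sign.
  have : ∑ p, remainderWeight lam b R p * (-(lam p : ℂ)) ^ l =
      (-1) ^ l * ∑ p, remainderWeight lam b R p * (lam p : ℂ) ^ l := by
    rw [Finset.mul_sum]
    refine Finset.sum_congr rfl fun p _ => ?_
    rw [neg_pow]
    ring
  rw [this, mul_eq_zero, or_iff_right (pow_ne_zero _ (neg_ne_zero.2 one_ne_zero))]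

theorem approx_Z_polyPhat (lam b : Fin m → ℝ) (M : ℝ) (Q : ℂ[X]) :
    (fun z : ℂ => Q.eval z * Z lam b M z - (polyPhat lam b M Q).eval z)
      =O[cobounded ℂ] fun z => z ^ (-1 : ℤ) := by
  refine (isBigO_congr ?_ EventuallyEq.rfl).2 (isBigO_sum_div_sub
    (fun i => (nuWeight lam b M i : ℂ) * Q.eval (nuNode lam i : ℂ)) fun i => (nuNode lam i : ℂ))
  filter_upwards [eventually_forall_sub_ne_zero fun i => (nuNode lam i : ℂ)] with z hz
  rw [Z_eq, eval_mul_sum_div_sub Q hz, polyPhat, add_sub_cancel_left]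

theorem approx_W_polyP (lam b : Fin m → ℝ) (Q : ℂ[X]) :
    (fun z : ℂ => Q.eval z * W lam b z - (polyP lam b Q).eval z)
      =O[cobounded ℂ] fun _ => (1 : ℂ) := by
  have h := ((isBigO_sum_div_sub (fun i => (b i : ℂ) * Q.eval (lam i : ℂ))
    fun i => (lam i : ℂ)).trans isBigO_zpow_neg_one_one).add (isBigO_const_const
      ((cauchyPart (fun i => (b i : ℂ)) (fun i => (lam i : ℂ)) Q).eval 0)
      (one_ne_zero (α := ℂ)) (cobounded ℂ))
  refine (isBigO_congr ?_ EventuallyEq.rfl).2 h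
  filter_upwards [eventually_forall_sub_ne_zero fun i => (lam i : ℂ)] with z hz
  rw [W, eval_mul_sum_div_sub Q hz, polyP, eval_sub, eval_C]
  ring

/-- The approximation problem is equivalent to the linear system for the coefficients of `Q`. -/
theorem isTypeI_iff (hpos : ∀ i, 0 < lam i) {R P Phat : ℂ[X]} {k : ℕ} (hR : R.natDegree ≤ k) :
    IsTypeI lam b M k (X * R) P Phat ↔
      P = polyP lam b (X * R) ∧ Phat = polyPhat lam b M (X * R) ∧
        (matAComplex lam b M (k + 1)).mulVec (fun j => R.coeff j) = -Pi.single 0 1 := by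
  constructor
  · intro h
    have hPhat : Phat = polyPhat lam b M (X * R) := by
      refine sub_eq_zero.1 (eq_zero_of_isBigO_inv ?_)
      refine ((approx_Z_polyPhat lam b M (X * R)).sub h.approx_Z).congr_left fun z => ?_
      rw [eval_sub]
      ring
    have hP : P = polyP lam b (X * R) := by
      -- A bounded polynomial is constant; `P(0) = 0` then makes the difference zero.
      have h1 : (P - polyP lam b (X * R)).natDegree = 0 := by
        refine natDegree_eq_zero_of_isBigO_one ?_
        refine ((approx_W_polyP lam b (X * R)).sub h.approx_W).congr_left fun z => ?_
        rw [eval_sub]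
        ring
      rw [← sub_eq_zero, eq_C_of_natDegree_eq_zero h1, coeff_zero_eq_eval_zero, eval_sub, h.P_zero,
        polyP, eval_sub, eval_C, sub_self, sub_self, C_0]
    subst hP hPhat
    exact ⟨rfl, rfl, (mulVec_eq_iff hR).2 ⟨h.Phat_zero, (symmetry_iff hpos R k).1 h.symmetry⟩⟩
  · rintro ⟨rfl, rfl, h⟩
    rw [mulVec_eq_iff hR] at h
    exact ⟨approx_Z_polyPhat lam b M _, approx_W_polyP lam b _, (symmetry_iff hpos R k).2 h.2,
      by simp, by simp [polyP], h.1⟩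

end CubicString

/-! ### The main theorem -/

theorem mainTheorem8 (n : ℕ) (hn : 1 ≤ n) (lam b : Fin (n - 1) → ℝ) (M : ℝ)
    (hlam_pos : ∀ i, 0 < lam i) (hlam_mono : StrictMono lam)
    (hb : ∀ i, b i < 0) (hM : 0 < M) (k : ℕ) (hk : k ≤ n - 1) :
    -- the determinant of the linear system
    (CubicString.matA lam b M (k + 1)).det = CubicString.detA lam b M (k + 1) ∧
    CubicString.detA lam b M (k + 1)
      = CubicString.detB lam b (k + 1) + CubicString.detC lam b k / (2 * M) ∧
    0 < CubicString.detA lam b M (k + 1) ∧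
    -- existence, with real coefficients and the exact degrees
    ∃ Q P Phat : Polynomial ℝ,
      Q.natDegree = k + 1 ∧ P.natDegree = k ∧ Phat.natDegree = k ∧
      CubicString.IsTypeI lam b M k (Q.map Complex.ofRealHom) (P.map Complex.ofRealHom)
        (Phat.map Complex.ofRealHom) ∧
      -- uniqueness, even among complex polynomials whose degrees are at most the given ones
      (∀ Q' P' Phat' : Polynomial ℂ,
        Q'.natDegree ≤ k + 1 → P'.natDegree ≤ k → Phat'.natDegree ≤ k →
        CubicString.IsTypeI lam b M k Q' P' Phat' →
          Q' = Q.map Complex.ofRealHom ∧ P' = P.map Complex.ofRealHom ∧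
            Phat' = Phat.map Complex.ofRealHom) ∧
      -- the coefficients of `Q` are the unique solution of the linear system
      (∀ q : Fin (k + 1) → ℝ,
        (CubicString.matA lam b M (k + 1)).mulVec q = -Pi.single 0 1 ↔
          ∀ j : Fin (k + 1), q j = Q.coeff ((j : ℕ) + 1)) ∧
      -- `P` and `Phat` are determined from `Q`
      P = CubicString.projPos
        (CubicString.WAtInfty lam b * CubicString.polyAtInfty Q) ∧
      Phat = CubicString.projNonneg
        (CubicString.ZAtInfty lam b M * CubicString.polyAtInfty Q) ∧
      Phat = -(1 / (2 * M)) • CubicString.diffQuot Q 0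
        + ∑ i, CubicString.cWeight lam b i • CubicString.diffQuot Q (lam i) := by
  have hA := CubicString.detA_succ_pos hlam_pos hlam_mono.injective hb hM hk
  refine ⟨rfl, CubicString.detA_succ_eq lam b M k, hA, ?_⟩
  set A := CubicString.matA lam b M (k + 1) with hAdef
  have hdet : IsUnit A.det := hA.ne'.isUnit
  have hinj : Function.Injective A.mulVec :=
    Matrix.mulVec_injective_of_isUnit ((Matrix.isUnit_iff_isUnit_det A).2 hdet)
  set q : Fin (k + 1) → ℝ := A⁻¹.mulVec (-Pi.single 0 1) with hqdef
  have hq : A.mulVec q = -Pi.single 0 1 := by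
    rw [hqdef, Matrix.mulVec_mulVec, Matrix.mul_nonsing_inv A hdet, Matrix.one_mulVec]
  have hlast : q (Fin.last k) ≠ 0 :=
    CubicString.mulVec_matA_last_ne_zero hlam_pos hlam_mono.injective hb hk hq
  -- The factor `X` in `Q = X * R` encodes `Q(0) = 0`, so the unknown `q_{j+1}` is the `j`-th
  -- coefficient of `R`.
  set R : ℝ[X] := ∑ j : Fin (k + 1), monomial (j : ℕ) (q j) with hRdef
  have hRcoeff : ∀ j : Fin (k + 1), R.coeff j = q j := fun j => by
    simp [hRdef, finsetSum_coeff, coeff_monomial, Fin.val_inj]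
  have hRle : R.natDegree ≤ k := natDegree_sum_le_of_forall_le _ _ fun j _ =>
    (natDegree_monomial_le _).trans (Nat.le_of_lt_succ j.2)
  have hRk : R.coeff k ≠ 0 := by
    have := hRcoeff (Fin.last k)
    rw [Fin.val_last] at this
    rwa [this]
  have hQle : (X * R).natDegree ≤ k + 1 := by
    refine natDegree_mul_le.trans ?_
    rw [natDegree_X]
    omega
  set Phat : ℝ[X] := CubicString.cauchyPart (CubicString.nuWeight lam b M)
    (CubicString.nuNode lam) (X * R) with hPhat
  set P : ℝ[X] := CubicString.cauchyPart b lam (X * R) -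
    C ((CubicString.cauchyPart b lam (X * R)).eval 0) with hP
  have hQmap : (X * R).map Complex.ofRealHom = X * R.map Complex.ofRealHom := by
    rw [Polynomial.map_mul, map_X]
  have hPhatmap : Phat.map Complex.ofRealHom =
      CubicString.polyPhat lam b M (X * R.map Complex.ofRealHom) := by
    rw [hPhat, CubicString.map_cauchyPart, hQmap]
    rfl
  have hPmap : P.map Complex.ofRealHom =
      CubicString.polyP lam b (X * R.map Complex.ofRealHom) := by
    rw [hP, Polynomial.map_sub, map_C, ← eval_map_apply, CubicString.map_cauchyPart, hQmap, map_zero]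
    rfl
  have hRmaple : (R.map Complex.ofRealHom).natDegree ≤ k := natDegree_map_le.trans hRle
  have hsys : (CubicString.matAComplex lam b M (k + 1)).mulVec
      (fun j => (R.map Complex.ofRealHom).coeff j) = -Pi.single 0 1 := by
    have h1 : (fun j : Fin (k + 1) => (R.map Complex.ofRealHom).coeff j) =
        Complex.ofRealHom ∘ q := by
      ext j
      rw [coeff_map, hRcoeff, Function.comp_apply]
    ext i
    rw [h1, CubicString.matAComplex, ← RingHom.map_mulVec, ← hAdef, hq]
    refine Fin.cases ?_ (fun i => ?_) i <;> simp
  refine ⟨X * R, P, Phat, ?_, ?_, ?_, ?_, ?_, ?_, ?_, ?_, ?_⟩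
  · exact natDegree_eq_of_le_of_coeff_ne_zero hQle (by rwa [coeff_X_mul])
  · rcases Nat.eq_zero_or_pos k with rfl | hk0
    · exact Nat.le_zero.1 ((natDegree_sub_C).le.trans
        (CubicString.natDegree_cauchyPart_le _ _ hQle))
    · rw [hP, natDegree_sub_C]
      refine natDegree_eq_of_le_of_coeff_ne_zero (CubicString.natDegree_cauchyPart_le _ _ hQle) ?_
      rw [CubicString.coeff_cauchyPart _ _ hQle, coeff_X_mul]
      -- Since `0 < k ≤ n - 1` there is at least one node, so the total mass of `μ` is strictly
      -- negative.
      refine mul_ne_zero (Finset.sum_neg (fun i _ => hb i) ⟨⟨0, by omega⟩, Finset.mem_univ _⟩).ne hRk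
  · refine natDegree_eq_of_le_of_coeff_ne_zero (CubicString.natDegree_cauchyPart_le _ _ hQle) ?_
    rw [CubicString.coeff_cauchyPart _ _ hQle, coeff_X_mul]
    refine mul_ne_zero (ne_of_lt ?_) hRk
    rw [Fin.sum_univ_succ]
    have h1 : ∑ i, CubicString.cWeight lam b i ≤ 0 := Finset.sum_nonpos fun i _ =>
      neg_nonpos.2 (Finset.sum_nonneg fun j _ => div_nonneg
        (mul_pos_of_neg_of_neg (hb j) (hb i)).le (add_pos (hlam_pos j) (hlam_pos i)).le)
    have h2 : 0 < 1 / (2 * M) := by positivity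
    simp only [CubicString.nuWeight, Fin.cons_zero, Fin.cons_succ]
    linarith
  · rw [hQmap]
    exact (CubicString.isTypeI_iff hlam_pos hRmaple).2 ⟨hPmap, hPhatmap, hsys⟩
  · intro Q' P' Phat' hQ' _ _ h
    obtain ⟨R', rfl⟩ : X ∣ Q' := by
      rw [X_dvd_iff, coeff_zero_eq_eval_zero]
      exact h.Q_zero
    have hR' : R'.natDegree ≤ k := by
      rcases eq_or_ne R' 0 with rfl | h0
      · simp
      · rw [natDegree_X_mul h0] at hQ'
        omega
    obtain ⟨h1, h2, h3⟩ := (CubicString.isTypeI_iff hlam_pos hR').1 h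
    have hdetC : IsUnit (CubicString.matAComplex lam b M (k + 1)).det := by
      have : (CubicString.matAComplex lam b M (k + 1)).det = Complex.ofRealHom A.det :=
        (RingHom.map_det _ _).symm
      rw [this]
      exact hdet.map _
    have h4 := Matrix.mulVec_injective_of_isUnit ((Matrix.isUnit_iff_isUnit_det _).2 hdetC)
      (h3.trans hsys.symm)
    have hRR : R' = R.map Complex.ofRealHom := by
      ext j
      rcases lt_or_ge k j with hj | hj
      · rw [coeff_eq_zero_of_natDegree_lt (hR'.trans_lt hj),
          coeff_eq_zero_of_natDegree_lt (hRmaple.trans_lt hj)]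
      · exact congrFun h4 ⟨j, Nat.lt_succ_of_le hj⟩
    subst hRR
    exact ⟨hQmap.symm, h1.trans hPmap.symm, h2.trans hPhatmap.symm⟩
  · intro q'
    simp only [coeff_X_mul, hRcoeff]
    rw [← funext_iff, ← hq]
    exact hinj.eq_iff
  · rw [CubicString.projPos, hP, CubicString.WAtInfty,
      ← CubicString.projNonneg_sum_cauchyAtInfty b lam (X * R)]
    congr 2
    -- The constant subtracted from `P` is the coefficient of `z ^ 0` in the Laurent series of `W
    -- Q`.
    rw [← coeff_zero_eq_eval_zero, CubicString.coeff_projNonneg]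
    simp
  · rw [hPhat, ← CubicString.projNonneg_sum_cauchyAtInfty, CubicString.ZAtInfty,
      Fin.sum_univ_succ]
    simp only [CubicString.nuWeight, CubicString.nuNode, Fin.cons_zero, Fin.cons_succ]
  · rw [hPhat, CubicString.cauchyPart, Fin.sum_univ_succ]
    simp only [CubicString.nuWeight, CubicString.nuNode, Fin.cons_zero, Fin.cons_succ,
      CubicString.diffQuot_eq, smul_eq_C_mul]
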